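/- **Attention layers and Transformers.** For $\lambda>0$ let $\mathrm{Softmax}_\lambda$ act on the columns of a matrix by $\mathrm{Softmax}_\lambda(u)_i=e^{\lambda u_i}/\sum_j e^{\lambda u_j}$. An $H$-head attention layer $\mathrm{Attn}:\mathbb{R}^{a\times m}\to\mathbb{R}^{b\times m}$ is a map $$\mathrm{Attn}(Z)=\sum_{h=1}^{H}W_V^{(h)}Z\,\mathrm{Softmax}_\lambda\big((W_K^{(h)}Z)^\top W_Q^{(h)}Z\big),\qquad W_K^{(h)},W_Q^{(h)}\in\mathbb{R}^{d_h\times a},\ W_V^{(h)}\in\mathbb{R}^{b\times a}.$$ Let $P(X)=\begin{bmatrix}X\ \ 0\\ I_{n+1}\end{bmatrix}$ for $X\in\mathbb{R}^{d\times n}$ (one zero token is padded and a positional encoding is appended), and let $T$ delete the last column. The class $\mathcal{T}(H,W,K,C_{KQ},C_V)$ at inverse temperature $\lambda$ consists of the maps $\tau=T\circ\mathrm{Attn}^{(K)}\circ\cdots\circ\mathrm{Attn}^{(1)}\circ P$, where each $\mathrm{Attn}^{(j)}$ is an $H$-head attention layer with inverse temperature $\lambda$, $W$ is the maximum of all token dimensions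 (including the input dimension $d+n+1$ of $\mathrm{Attn}^{(1)}$ and the output dimension) and of all head dimensions $d_h$, $C_V$ is the maximum over all layers and heads of $\|W_V\|_F$, and $C_{KQ}$ is the maximum of $\|W_K^\top W_Q\|_F$. A map on scalars is understood with $d=n=1$ and output dimension $1$, so that the input is a $1\times 1$ matrix. **Proposition (Approximation of the square root).** There are an absolute constant $C>0$ and real polynomials $p,q$ such that the following holds. For every $C_X>0$ and every $\epsilon\in(0,1)$ there are $H,W,K\in\mathbb{N}$, $C_{KQ},C_V,\lambda>0$ and a Transformer $f_{\mathrm{root}}\in\mathcal{T}(H,W,K,C_{KQ},C_V)$ with inverse temperature $\lambda$ such that $$|f_{\mathrm{root}}(x')-\sqrt{x}|\le 2\epsilon+\frac{|x'-x|}{\sqrt{\epsilon}}\qquad\text{for all }x'\in[-C_X,C_X],\ x\in[\epsilon,1/\epsilon].$$ Moreover, if $C_X\ge 1$ and $\epsilon\le 1/2$, then with $\delta=1/\epsilon$ the same network satisfies $$H\le C\ln^3\delta,\quad W\le C\ln^3\delta,\quad K\le C\ln^2\delta,\quad C_V\le C\,\delta\sqrt{\ln^3\delta},\quad C_{KQ}\le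 C\sqrt{\ln^2\delta\cdot\ln(\delta C_X)},$$ $$\lambda\le C\,\delta^{\,p(\ln\delta)}\,(\ln\delta)^{\,q(\ln\delta)}\,\ln(\delta C_X).$$ -/

import Mathlib

noncomputable section

/-- Column-wise softmax with inverse temperature `lam`. -/
def colSoftmax {m n : ℕ} (lam : ℝ) (S : Matrix (Fin m) (Fin n) ℝ) : Matrix (Fin m) (Fin n) ℝ :=
  Matrix.of fun p q => Real.exp (lam * S p q) / ∑ r, Real.exp (lam * S r q)

/-- The weights of one attention head, with its own key/query dimension `dh`. -/
structure AttnHead (dIn dOut : ℕ) where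
  dh : ℕ
  WK : Matrix (Fin dh) (Fin dIn) ℝ
  WQ : Matrix (Fin dh) (Fin dIn) ℝ
  WV : Matrix (Fin dOut) (Fin dIn) ℝ

/-- The key-query matrix `W_Kᵀ W_Q` of a head. -/
def AttnHead.WKQ {dIn dOut : ℕ} (h : AttnHead dIn dOut) : Matrix (Fin dIn) (Fin dIn) ℝ :=
  h.WK.transpose * h.WQ

/-- The map `Z ↦ W_V Z Softmax_lam((W_K Z)ᵀ W_Q Z)` computed by one head. -/
def AttnHead.eval {dIn dOut m : ℕ} (h : AttnHead dIn dOut) (lam : ℝ)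
    (Z : Matrix (Fin dIn) (Fin m) ℝ) : Matrix (Fin dOut) (Fin m) ℝ :=
  h.WV * Z * colSoftmax lam ((h.WK * Z).transpose * (h.WQ * Z))

/-- The multi-head attention layer: the sum of its `H` heads. -/
def attnLayer {H dIn dOut m : ℕ} (heads : Fin H → AttnHead dIn dOut) (lam : ℝ)
    (Z : Matrix (Fin dIn) (Fin m) ℝ) : Matrix (Fin dOut) (Fin m) ℝ :=
  ∑ h, (heads h).eval lam Z

/-- A finite sequence of `H`-head attention layers with composable token dimensions; the first
layer of `cons` acts first. -/
inductive AttnStack (H : ℕ) : ℕ → ℕ → Type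
  | nil (d : ℕ) : AttnStack H d d
  | cons {a b c : ℕ} (layer : Fin H → AttnHead a b) (rest : AttnStack H b c) : AttnStack H a c

namespace AttnStack

/-- The composition of the layers. -/
def eval {H m : ℕ} (lam : ℝ) : {a c : ℕ} → AttnStack H a c →
    Matrix (Fin a) (Fin m) ℝ → Matrix (Fin c) (Fin m) ℝ
  | _, _, nil _, Z => Z
  | _, _, cons layer rest, Z => eval lam rest (attnLayer layer lam Z)

/-- The number of layers. -/
def depth {H : ℕ} : {a c : ℕ} → AttnStack H a c → ℕ
  | _, _, nil _ => 0
  | _, _, cons _ rest => depth rest + 1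

/-- The maximum of all token dimensions (input and output included) and of all key/query
dimensions of heads. -/
def width {H : ℕ} : {a c : ℕ} → AttnStack H a c → ℕ
  | _, _, nil d => d
  | a, _, cons layer rest =>
      max (max a (Finset.univ.sup fun h => (layer h).dh)) (width rest)

open scoped Matrix.Norms.Frobenius in
/-- The maximal Frobenius norm of a value matrix. -/
def maxNormV {H : ℕ} : {a c : ℕ} → AttnStack H a c → ℝ
  | _, _, nil _ => 0
  | _, _, cons layer rest => max (⨆ h, ‖(layer h).WV‖) (maxNormV rest)

open scoped Matrix.Norms.Frobenius in
/-- The maximal Frobenius norm of a key-query matrix `W_Kᵀ W_Q`. -/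
def maxNormKQ {H : ℕ} : {a c : ℕ} → AttnStack H a c → ℝ
  | _, _, nil _ => 0
  | _, _, cons layer rest => max (⨆ h, ‖(layer h).WKQ‖) (maxNormKQ rest)

end AttnStack

/-- The preprocessing layer: pad one zero token and append the positional encoding, that is
`X ↦ [X, 0; I]`, where the lower block is the identity matrix of size `n + 1`. -/
def preprocess {d n : ℕ} (X : Matrix (Fin d) (Fin n) ℝ) :
    Matrix (Fin (d + (n + 1))) (Fin (n + 1)) ℝ :=
  Matrix.of fun r c =>
    Fin.addCases (fun i : Fin d => (Fin.snoc (X i) 0 : Fin (n + 1) → ℝ) c)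
      (fun k : Fin (n + 1) => if k = c then (1 : ℝ) else 0) r

/-- The truncation layer: delete the last token. -/
def truncateLast {d n : ℕ} (Y : Matrix (Fin d) (Fin (n + 1)) ℝ) : Matrix (Fin d) (Fin n) ℝ :=
  Y.submatrix id Fin.castSucc

/-- The Transformer network class with `H` heads per layer, width `W`, `K` attention layers, maximal
key-query norm `CKQ`, maximal value norm `CV`, all of whose softmaxes have inverse temperature
`lam`; its members map `d × n` inputs to `dOut × n` outputs. -/
def TransformerClass (d n dOut H W K : ℕ) (CKQ CV lam : ℝ) :
    Set (Matrix (Fin d) (Fin n) ℝ → Matrix (Fin dOut) (Fin n) ℝ) :=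
  {τ | ∃ s : AttnStack H (d + (n + 1)) dOut,
    s.depth = K ∧ s.width = W ∧ s.maxNormKQ = CKQ ∧ s.maxNormV = CV ∧
      ∀ X, τ X = truncateLast (s.eval lam (preprocess X))}

end

/-! ### Elementary bounds for the hyperbolic tangent -/

/-! The network runs bisection, `y ← y + s · sign(x - y²)` with `s` halved each time. On two tokens
a softmax column is a sigmoid, so attention can compute a linear map plus a linear map gated by
`tanh` (`attnLayer_gateHeads`). This supplies both nonlinearities: `y * tanh (η * y)` is about `η *
y²` for small `η`, and `tanh (Λ * t)` is a soft sign for large `Λ`. Two layers make one bisection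
step.

The soft sign is reliable only when `|y - r| > μ`, and then only up to `τ`; `abs_softBisect_sub_le`
shows that these defects add at most `μ + τ * R` and do not accumulate. Bisection on `[0, R]` with
`R² = 1/ε` converges to the root `r` of the input clipped to `[0, R²]`, for every real input, and
`abs_clippedSqrt_sub_sqrt_le` compares `r` with `√x`. Three heads, width 5 and about `6 ln δ` layers
suffice, so the size bounds hold with much room. -/

theorem sigmoid_sub_half (v : ℝ) :
    Real.exp v / (Real.exp v + 1) - 1 / 2 = 1 / 2 * Real.tanh (v / 2) := by
  have h1 : Real.exp v = Real.exp (v / 2) * Real.exp (v / 2) := by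
    rw [← Real.exp_add]; ring_nf
  have h3 := Real.exp_pos (v / 2)
  rw [Real.tanh_eq, h1, Real.exp_neg]
  field_simp
  ring

/-- This decay, far weaker than the exponential one, is enough because the inverse temperature may
be polynomial in `1/ε`. -/
theorem one_sub_tanh_le {v : ℝ} (hv : 0 ≤ v) : 1 - Real.tanh v ≤ 1 / (1 + v) := by
  have h := sigmoid_sub_half (2 * v)
  have h1 : 2 * v / 2 = v := by ring
  rw [h1] at h
  have h2 := Real.add_one_le_exp (2 * v)
  have h3 : 1 - Real.tanh v = 2 / (Real.exp (2 * v) + 1) := by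
    have : Real.tanh v = 2 * (Real.exp (2 * v) / (Real.exp (2 * v) + 1) - 1 / 2) := by linarith
    rw [this]
    field_simp
    ring
  rw [h3, div_le_div_iff₀ (by positivity) (by positivity)]
  linarith

theorem tanh_le_self {v : ℝ} (hv : 0 ≤ v) : Real.tanh v ≤ v := by
  rw [Real.tanh_eq_sinh_div_cosh, div_le_iff₀ (Real.cosh_pos v)]
  have h : MonotoneOn (fun u : ℝ => u * Real.cosh u - Real.sinh u) (Set.Ici 0) := by
    apply monotoneOn_of_deriv_nonneg (convex_Ici 0)
    · fun_prop
    · fun_prop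
    · intro u hu
      have hu' : 0 < u := by simpa using hu
      have hd : HasDerivAt (fun u : ℝ => u * Real.cosh u - Real.sinh u)
          (1 * Real.cosh u + u * Real.sinh u - Real.cosh u) u :=
        ((hasDerivAt_id u).mul (Real.hasDerivAt_cosh u)).sub (Real.hasDerivAt_sinh u)
      rw [hd.deriv]
      have := Real.sinh_nonneg_iff.2 hu'.le
      nlinarith [mul_nonneg hu'.le this]
  have := h (Set.mem_Ici.2 le_rfl) (Set.mem_Ici.2 hv) hv
  simp at this
  exact this

/-- Since `v ≤ sinh v`, `tanh v` is at least `v / cosh v`, and `1 / cosh v ≥ exp (-v²/2) ≥ 1 -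
v²/2`. -/
theorem self_sub_tanh_le {v : ℝ} (hv : 0 ≤ v) : v - Real.tanh v ≤ v ^ 3 := by
  have h1 : v / Real.cosh v ≤ Real.tanh v := by
    rw [Real.tanh_eq_sinh_div_cosh]
    have := Real.self_le_sinh_iff.2 hv
    have := Real.cosh_pos v
    gcongr
  have h2 : 1 - v ^ 2 / 2 ≤ 1 / Real.cosh v := by
    have h := Real.cosh_le_exp_half_sq v
    have h' := Real.add_one_le_exp (-(v ^ 2 / 2))
    rw [Real.exp_neg] at h'
    calc 1 - v ^ 2 / 2 ≤ (Real.exp (v ^ 2 / 2))⁻¹ := by linarith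
      _ ≤ 1 / Real.cosh v := by
        rw [one_div]
        exact inv_anti₀ (Real.cosh_pos v) h
  have h3 : v * (1 - v ^ 2 / 2) ≤ v * (1 / Real.cosh v) := mul_le_mul_of_nonneg_left h2 hv
  rw [mul_one_div] at h3
  nlinarith [pow_nonneg hv 3]

/-! ### Soft bisection for the square root -/

/-- `n` steps of bisection for `√x` with first step width `s` and current approximation `y`, where
the square and the sign are replaced by hyperbolic tangents. -/
noncomputable def softBisect (η Λ x : ℝ) : ℕ → ℝ → ℝ → ℝ
  | 0, _, y => y
  | n + 1, s, y =>
      softBisect η Λ x n (s / 2) (y + s * Real.tanh (Λ * (η * x - y * Real.tanh (η * y))))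

theorem abs_softSquare_sub_le {η y R : ℝ} (hη : 0 ≤ η) (hy : 0 ≤ y) (hyR : y ≤ R) :
    |y * Real.tanh (η * y) - η * y ^ 2| ≤ η ^ 3 * R ^ 4 := by
  have hv : 0 ≤ η * y := mul_nonneg hη hy
  have h1 := mul_le_mul_of_nonneg_left (tanh_le_self hv) hy
  have h2 := mul_le_mul_of_nonneg_left (self_sub_tanh_le hv) hy
  have h3 : η ^ 3 * y ^ 4 ≤ η ^ 3 * R ^ 4 := by gcongr
  rw [abs_le]
  constructor
  · nlinarith
  · have : 0 ≤ η ^ 3 * R ^ 4 := by positivity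
    nlinarith

/-- One step: `g` is the soft sign of `x - y ^ 2`. -/
theorem abs_bisect_step_sub_le {y r s τ μ E g : ℝ} (hs : 0 ≤ s)
    (hg : |g| ≤ 1) (hlow : y < r - μ → 1 - τ ≤ g) (hhigh : r + μ < y → g ≤ -(1 - τ))
    (hE : μ + τ * s ≤ E) (hμ : 0 ≤ μ) (hy : |y - r| ≤ (1 - τ) * (2 * s) + E) :
    |y + s * g - r| ≤ (1 - τ) * s + E := by
  rw [abs_le] at *
  have h1 : s * g ≤ s * 1 := mul_le_mul_of_nonneg_left hg.2 hs
  have h2 : s * (-1) ≤ s * g := mul_le_mul_of_nonneg_left hg.1 hs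
  -- Outside the dead zone `|y - r| ≤ μ` the step goes towards `r` by between `(1 - τ) * s` and `s`.
  -- Inside it, or after overshooting, the new distance is at most `μ + s`, and `E` absorbs `μ + τ *
  -- s`.
  by_cases ha : y < r - μ
  · have := mul_le_mul_of_nonneg_left (hlow ha) hs
    constructor <;> nlinarith
  · by_cases hb : r + μ < y
    · have := mul_le_mul_of_nonneg_left (hhigh hb) hs
      constructor <;> nlinarith
    · constructor <;> nlinarith

theorem le_tanh_of_le {τ a v : ℝ} (hτ : 0 < τ) (ha : 1 / τ ≤ a) (hv : a ≤ v) :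
    1 - τ ≤ Real.tanh v := by
  have h0 : 0 < 1 / τ := by positivity
  have h := one_sub_tanh_le (v := v) (by linarith)
  have h1 : 1 / (1 + v) ≤ τ := by
    rw [div_le_iff₀ (by linarith)]
    have : τ * (1 / τ) = 1 := by field_simp
    nlinarith
  linarith

/-- The invariant `2 * s ≤ y ≤ R - 2 * s` survives each step and keeps `y` in `[0, R]`. Hence `y < r
- μ` forces `0 < r`, and `r + μ < y` forces `r < R`, which is why clipping at either end does no
harm. -/
theorem abs_softBisect_sub_le {η Λ x R μ τ r : ℝ} (hη : 0 < η) (hΛ : 0 < Λ) (hR : 0 < R)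
    (hμ : 0 < μ) (hτ0 : 0 < τ) (hη2 : η ^ 2 * R ^ 4 ≤ μ ^ 2 / 2)
    (hΛτ : 1 / τ ≤ Λ * (η * μ ^ 2 / 2)) (hr0 : 0 ≤ r)
    (hrlow : 0 < r → r ^ 2 ≤ x) (hrhigh : r < R → x ≤ r ^ 2) (n : ℕ) :
    ∀ s y : ℝ, 0 ≤ s → 2 * s ≤ y → y ≤ R - 2 * s →
      |y - r| ≤ (1 - τ) * (2 * s) + (μ + τ * R) →
      |softBisect η Λ x n s y - r| ≤ (1 - τ) * (2 * s / 2 ^ n) + (μ + τ * R) := by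
  induction n with
  | zero => intro s y _ _ _ h; simpa [softBisect] using h
  | succ n ih =>
    intro s y hs hy1 hy2 hy
    have hy0 : 0 ≤ y := by linarith
    have hsq := abs_le.1 (abs_softSquare_sub_le hη.le hy0 (by linarith : y ≤ R))
    -- The error of the soft square is at most half of the signal `η * μ²` present outside the dead
    -- zone.
    have hcube : η ^ 3 * R ^ 4 ≤ η * (μ ^ 2 / 2) := by
      calc η ^ 3 * R ^ 4 = η * (η ^ 2 * R ^ 4) := by ring
        _ ≤ _ := mul_le_mul_of_nonneg_left hη2 hη.le
    set t := η * x - y * Real.tanh (η * y) with ht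
    have hg : |Real.tanh (Λ * t)| ≤ 1 := (Real.abs_tanh_lt_one _).le
    have hlow : y < r - μ → 1 - τ ≤ Real.tanh (Λ * t) := by
      intro h
      have hx := hrlow (by linarith)
      have hxy : μ ^ 2 ≤ x - y ^ 2 := by nlinarith
      have := mul_le_mul_of_nonneg_left hxy hη.le
      exact le_tanh_of_le hτ0 hΛτ (mul_le_mul_of_nonneg_left (by nlinarith) hΛ.le)
    have hhigh : r + μ < y → Real.tanh (Λ * t) ≤ -(1 - τ) := by
      intro h
      have hx := hrhigh (by linarith)
      have hxy : μ ^ 2 ≤ y ^ 2 - x := by nlinarith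
      have := mul_le_mul_of_nonneg_left hxy hη.le
      have := le_tanh_of_le hτ0 hΛτ (mul_le_mul_of_nonneg_left
        (by nlinarith : η * μ ^ 2 / 2 ≤ -t) hΛ.le)
      rw [mul_neg, Real.tanh_neg] at this
      linarith
    have hstep := abs_bisect_step_sub_le (E := μ + τ * R) hs hg hlow hhigh
      (by nlinarith) hμ.le hy
    have hg' := abs_le.1 hg
    have h1 : s * Real.tanh (Λ * t) ≤ s * 1 := mul_le_mul_of_nonneg_left hg'.2 hs
    have h2 : s * (-1) ≤ s * Real.tanh (Λ * t) := mul_le_mul_of_nonneg_left hg'.1 hs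
    have := ih (s / 2) (y + s * Real.tanh (Λ * t)) (by linarith) (by linarith) (by linarith)
      (by convert hstep using 3; ring)
    rw [softBisect]
    convert this using 3
    rw [pow_succ]; field_simp

/-- The square root of the projection of `x'` to `[0, R ^ 2]`. -/
theorem abs_clippedSqrt_sub_sqrt_le {ε x' x R : ℝ} (hε : 0 < ε)
    (hx : ε ≤ x) (hxR : x ≤ R ^ 2) :
    |Real.sqrt (max 0 (min x' (R ^ 2))) - Real.sqrt x| ≤ |x' - x| / Real.sqrt ε := by
  set c := max 0 (min x' (R ^ 2)) with hc
  have hc0 : 0 ≤ c := le_max_left _ _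
  have hx0 : 0 ≤ x := by linarith
  have hcx : |c - x| ≤ |x' - x| := by
    have h1 : x = max 0 (min x (R ^ 2)) := by rw [min_eq_left hxR, max_eq_right hx0]
    rw [hc]
    nth_rewrite 1 [h1]
    calc _ ≤ |min x' (R ^ 2) - min x (R ^ 2)| := by
          have := abs_max_sub_max_le_max 0 (min x' (R ^ 2)) 0 (min x (R ^ 2))
          simpa using this
      _ ≤ _ := by
          have := abs_min_sub_min_le_max x' (R ^ 2) x (R ^ 2)
          simpa using this
  have hsε : 0 < Real.sqrt ε := Real.sqrt_pos.2 hε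
  rw [le_div_iff₀ hsε]
  refine le_trans ?_ hcx
  -- Clipping is 1-Lipschitz and fixes `x`; the second factor is at least `√ε`.
  have h2 : c - x = (Real.sqrt c - Real.sqrt x) * (Real.sqrt c + Real.sqrt x) := by
    have e1 := Real.sq_sqrt hc0
    have e2 := Real.sq_sqrt hx0
    linear_combination e2 - e1
  rw [h2, abs_mul, abs_of_nonneg (a := Real.sqrt c + Real.sqrt x) (by positivity)]
  have := Real.sqrt_le_sqrt hx
  gcongr
  linarith [Real.sqrt_nonneg c]

/-! ### Attention layers acting on two tokens as gated linear maps -/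

open scoped Matrix.Norms.Frobenius

theorem frobenius_norm_le_of_abs_entry_le {m n : ℕ} (A : Matrix (Fin m) (Fin n) ℝ) {B : ℝ}
    (hB : 0 ≤ B) (h : ∀ i j, |A i j| ≤ B) : ‖A‖ ≤ m * n * B := by
  by_cases hmn : m * n = 0
  · have : A = 0 := by
      ext i j
      rcases Nat.mul_eq_zero.1 hmn with h0 | h0
      · subst h0; exact i.elim0
      · subst h0; exact j.elim0
    rw [this, norm_zero]
    positivity
  have h1 : (1 : ℝ) ≤ (m : ℝ) * n := by exact_mod_cast Nat.one_le_iff_ne_zero.2 hmn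
  rw [Matrix.frobenius_norm_def, ← Real.sqrt_eq_rpow]
  apply Real.sqrt_le_iff.2 ⟨by positivity, ?_⟩
  calc ∑ i, ∑ j, ‖A i j‖ ^ (2 : ℝ) ≤ ∑ _i : Fin m, ∑ _j : Fin n, B ^ 2 := by
        refine Finset.sum_le_sum fun i _ => Finset.sum_le_sum fun j _ => ?_
        rw [Real.norm_eq_abs, Real.rpow_two]
        exact pow_le_pow_left₀ (abs_nonneg _) (h i j) 2
    _ = (m * n) * B ^ 2 := by simp; ring
    _ ≤ (m * n) ^ 2 * B ^ 2 := by
        have : (m * n : ℝ) ≤ (m * n) ^ 2 := by nlinarith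
        gcongr
    _ = _ := by ring

/-- Three heads: a gate that compares the token marked by the coordinate `i₁` with the other one, a
head by which each of the tokens marked by `i₁` and `i₂` attends to itself, and a uniform head. -/
noncomputable def gateHeads {a b : ℕ} (lam : ℝ) (i₁ i₂ : Fin a) (L V : Matrix (Fin b) (Fin a) ℝ)
    (w : Fin a → ℝ) : Fin 3 → AttnHead a b :=
  ![{ dh := 1
      WK := Matrix.of fun _ j => if j = i₁ then 1 else 0
      WQ := Matrix.of fun _ j => w j
      WV := V },
    { dh := 2
      WK := Matrix.of fun k j => if j = ![i₁, i₂] k then 1 else 0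
      WQ := Matrix.of fun k j => if j = ![i₁, i₂] k then 1 else 0
      WV := ((Real.exp lam + 1) / (Real.exp lam - 1)) • L },
    { dh := 1
      WK := 0
      WQ := 0
      WV := -V - (2 / (Real.exp lam - 1)) • L }]

theorem AttnHead.eval_two_tokens {a b : ℕ} (h : AttnHead a b) (lam : ℝ)
    (Z : Matrix (Fin a) (Fin 2) ℝ) (r : Fin b) (q : Fin 2) {s₀ s₁ : ℝ}
    (h₀ : ∑ k, (h.WK * Z) k 0 * (h.WQ * Z) k q = s₀)
    (h₁ : ∑ k, (h.WK * Z) k 1 * (h.WQ * Z) k q = s₁) :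
    h.eval lam Z r q =
      (h.WV * Z) r 0 * (Real.exp (lam * s₀) / (Real.exp (lam * s₀) + Real.exp (lam * s₁))) +
      (h.WV * Z) r 1 * (Real.exp (lam * s₁) / (Real.exp (lam * s₀) + Real.exp (lam * s₁))) := by
  subst h₀ h₁
  rw [AttnHead.eval, Matrix.mul_apply, Fin.sum_univ_two]
  simp only [colSoftmax, Matrix.of_apply, Fin.sum_univ_two,
    Matrix.mul_apply (M := Matrix.transpose _), Matrix.transpose_apply]

/-- On two tokens marked by the coordinates `i₁`, `i₂`, the gate heads compute a linear map plus,
on the first token, a linear map gated by a hyperbolic tangent. -/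
theorem attnLayer_gateHeads {a b : ℕ} {lam : ℝ} (hlam : 0 < lam) {i₁ i₂ : Fin a}
    (L V : Matrix (Fin b) (Fin a) ℝ) (w : Fin a → ℝ) (Z : Matrix (Fin a) (Fin 2) ℝ)
    (h10 : Z i₁ 0 = 1) (h11 : Z i₁ 1 = 0) (h20 : Z i₂ 0 = 0) (h21 : Z i₂ 1 = 1)
    (hw : ∑ j, w j * Z j 1 = 0) :
    attnLayer (gateHeads lam i₁ i₂ L V w) lam Z = Matrix.of fun r => ![
      (L * Z) r 0 + 1 / 2 * Real.tanh (lam / 2 * ∑ j, w j * Z j 0) * ((V * Z) r 0 - (V * Z) r 1),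
      (L * Z) r 1] := by
  have hE : Real.exp lam - 1 ≠ 0 := by
    have := Real.add_one_lt_exp hlam.ne'
    linarith
  have hE1 : Real.exp lam + 1 ≠ 0 := by positivity
  ext r q
  have hσ := sigmoid_sub_half (lam * ∑ j, w j * Z j 0)
  have hexp := Real.exp_pos (lam * ∑ j, w j * Z j 0)
  have harg : lam * (∑ j, w j * Z j 0) / 2 = lam / 2 * ∑ j, w j * Z j 0 := by ring
  rw [harg] at hσ
  have hgate : ∀ q : Fin 2, ((gateHeads lam i₁ i₂ L V w) 0).eval lam Z r q = _ := fun q =>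
    AttnHead.eval_two_tokens _ lam Z r q (s₀ := ∑ j, w j * Z j q) (s₁ := 0)
      (by
        change ∑ k : Fin 1,
          ((Matrix.of fun (_ : Fin 1) (j : Fin a) => if j = i₁ then (1 : ℝ) else 0) * Z) k 0 *
            ((Matrix.of fun (_ : Fin 1) (j : Fin a) => w j) * Z) k q = _
        simp [Matrix.mul_apply, h10])
      (by
        change ∑ k : Fin 1,
          ((Matrix.of fun (_ : Fin 1) (j : Fin a) => if j = i₁ then (1 : ℝ) else 0) * Z) k 1 *
            ((Matrix.of fun (_ : Fin 1) (j : Fin a) => w j) * Z) k q = _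
        simp [Matrix.mul_apply, h11])
  have hself : ∀ q : Fin 2, ((gateHeads lam i₁ i₂ L V w) 1).eval lam Z r q = _ := fun q =>
    AttnHead.eval_two_tokens _ lam Z r q (s₀ := ![1, 0] q) (s₁ := ![0, 1] q)
      (by
        change ∑ k : Fin 2,
          ((Matrix.of fun (k : Fin 2) (j : Fin a) => if j = ![i₁, i₂] k then (1 : ℝ) else 0) * Z) k 0 *
            ((Matrix.of fun (k : Fin 2) (j : Fin a) => if j = ![i₁, i₂] k then (1 : ℝ) else 0) * Z) k q = _
        fin_cases q <;> simp [Matrix.mul_apply, Fin.sum_univ_two, h10, h11, h20])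
      (by
        change ∑ k : Fin 2,
          ((Matrix.of fun (k : Fin 2) (j : Fin a) => if j = ![i₁, i₂] k then (1 : ℝ) else 0) * Z) k 1 *
            ((Matrix.of fun (k : Fin 2) (j : Fin a) => if j = ![i₁, i₂] k then (1 : ℝ) else 0) * Z) k q = _
        fin_cases q <;> simp [Matrix.mul_apply, Fin.sum_univ_two, h11, h20, h21])
  have hunif : ∀ q : Fin 2, ((gateHeads lam i₁ i₂ L V w) 2).eval lam Z r q = _ := fun q =>
    AttnHead.eval_two_tokens _ lam Z r q (s₀ := 0) (s₁ := 0)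
      (by
        change ∑ k : Fin 1, ((0 : Matrix (Fin 1) (Fin a) ℝ) * Z) k 0 *
          ((0 : Matrix (Fin 1) (Fin a) ℝ) * Z) k q = _
        simp)
      (by
        change ∑ k : Fin 1, ((0 : Matrix (Fin 1) (Fin a) ℝ) * Z) k 1 *
          ((0 : Matrix (Fin 1) (Fin a) ℝ) * Z) k q = _
        simp)
  have hsum : attnLayer (gateHeads lam i₁ i₂ L V w) lam Z r q =
      (gateHeads lam i₁ i₂ L V w 0).eval lam Z r q + (gateHeads lam i₁ i₂ L V w 1).eval lam Z r q +
        (gateHeads lam i₁ i₂ L V w 2).eval lam Z r q := by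
    simp [attnLayer, Fin.sum_univ_three, Matrix.add_apply]
  have hV0 : (gateHeads lam i₁ i₂ L V w 0).WV = V := rfl
  have hV1 : (gateHeads lam i₁ i₂ L V w 1).WV =
      ((Real.exp lam + 1) / (Real.exp lam - 1)) • L := rfl
  have hV2 : (gateHeads lam i₁ i₂ L V w 2).WV = -V - (2 / (Real.exp lam - 1)) • L := rfl
  -- The self-attending head, rescaled, yields `(e^lam * own + other) / (e^lam - 1)`, and the
  -- uniform head subtracts `(own + other) / (e^lam - 1)`, leaving `L` exactly. Its `-V` part turns
  -- the gate's sigmoid into sigmoid minus `1/2`, which vanishes on the second token.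
  rw [hsum, hgate, hself, hunif, hV0, hV1, hV2, Matrix.sub_mul, Matrix.neg_mul, Matrix.smul_mul,
    Matrix.smul_mul]
  simp only [Matrix.sub_apply, Matrix.neg_apply, Matrix.smul_apply, smul_eq_mul, mul_zero,
    Real.exp_zero, Matrix.of_apply]
  generalize (L * Z) r 0 = l₀, (L * Z) r 1 = l₁, (V * Z) r 0 = v₀, (V * Z) r 1 = v₁
  fin_cases q
  · simp only [Fin.zero_eta, Matrix.cons_val_zero, mul_one, mul_zero, Real.exp_zero]
    rw [← hσ]
    field_simp
    ring
  · simp only [Fin.mk_one, Matrix.cons_val_one, Matrix.cons_val_zero, hw, mul_one, mul_zero,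
      Real.exp_zero]
    field_simp
    ring

/-! ### Norm bounds for gated layers -/

theorem norm_WKQ_gateHeads_le {a b : ℕ} (lam : ℝ) (i₁ i₂ : Fin a) (L V : Matrix (Fin b) (Fin a) ℝ)
    {w : Fin a → ℝ} (hw : ∀ j, |w j| ≤ 1) (h : Fin 3) :
    ‖(gateHeads lam i₁ i₂ L V w h).WKQ‖ ≤ 4 * a ^ 2 := by
  have ha : (1 : ℝ) ≤ a := by exact_mod_cast (Nat.one_le_iff_ne_zero.2 (by
    rintro rfl; exact i₁.elim0))
  have hind : ∀ (p : Prop) [Decidable p], |(if p then (1 : ℝ) else 0)| ≤ 1 := by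
    intro p _; split <;> simp
  unfold AttnHead.WKQ
  refine (Matrix.frobenius_norm_mul _ _).trans ?_
  rw [Matrix.frobenius_norm_transpose]
  fin_cases h
  · have h1 : ‖(gateHeads lam i₁ i₂ L V w 0).WK‖ ≤ (1 : ℕ) * a * 1 :=
      frobenius_norm_le_of_abs_entry_le _ zero_le_one fun i j => hind _
    have h2 : ‖(gateHeads lam i₁ i₂ L V w 0).WQ‖ ≤ (1 : ℕ) * a * 1 :=
      frobenius_norm_le_of_abs_entry_le _ zero_le_one fun i j => hw j
    refine (mul_le_mul h1 h2 (norm_nonneg _) (by positivity)).trans ?_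
    push_cast
    nlinarith
  · have h1 : ‖(gateHeads lam i₁ i₂ L V w 1).WK‖ ≤ (2 : ℕ) * a * 1 :=
      frobenius_norm_le_of_abs_entry_le _ zero_le_one fun i j => hind _
    have h2 : ‖(gateHeads lam i₁ i₂ L V w 1).WQ‖ ≤ (2 : ℕ) * a * 1 :=
      frobenius_norm_le_of_abs_entry_le _ zero_le_one fun i j => hind _
    refine (mul_le_mul h1 h2 (norm_nonneg _) (by positivity)).trans ?_
    push_cast
    nlinarith
  · have h1 : ‖(gateHeads lam i₁ i₂ L V w 2).WK‖ = 0 := norm_zero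
    change ‖(gateHeads lam i₁ i₂ L V w 2).WK‖ * _ ≤ _
    rw [h1, zero_mul]
    positivity

theorem norm_WV_gateHeads_le {a b : ℕ} {lam M : ℝ} (hlam : 2 ≤ lam) (hM : 0 ≤ M) (i₁ i₂ : Fin a)
    {L V : Matrix (Fin b) (Fin a) ℝ} (w : Fin a → ℝ) (hL : ∀ i j, |L i j| ≤ M)
    (hV : ∀ i j, |V i j| ≤ M) (h : Fin 3) :
    ‖(gateHeads lam i₁ i₂ L V w h).WV‖ ≤ b * a * (2 * M) := by
  -- From `lam ≥ 2` follows `e^lam ≥ 3`, which bounds the two scalar coefficients by 2 and 1.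
  have hexp := Real.add_one_le_exp lam
  have hα : |(Real.exp lam + 1) / (Real.exp lam - 1)| ≤ 2 := by
    rw [abs_of_nonneg (div_nonneg (by linarith) (by linarith)), div_le_iff₀ (by linarith)]
    linarith
  have hβ : |2 / (Real.exp lam - 1)| ≤ 1 := by
    rw [abs_of_nonneg (div_nonneg (by linarith) (by linarith)), div_le_iff₀ (by linarith)]
    linarith
  apply frobenius_norm_le_of_abs_entry_le _ (by positivity)
  intro i j
  fin_cases h
  · exact (hV i j).trans (by linarith)
  · change |((Real.exp lam + 1) / (Real.exp lam - 1)) * L i j| ≤ _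
    rw [abs_mul]
    exact mul_le_mul hα (hL i j) (abs_nonneg _) (by norm_num)
  · change |-V i j - (2 / (Real.exp lam - 1)) * L i j| ≤ _
    have h1 : |(2 / (Real.exp lam - 1)) * L i j| ≤ 1 * M := by
      rw [abs_mul]
      exact mul_le_mul hβ (hL i j) (abs_nonneg _) (by norm_num)
    refine (abs_sub _ _).trans ?_
    rw [abs_neg]
    linarith [hV i j]

namespace AttnStack

/-- A bound for the width and the two norms of a stack. -/
def BoundedBy {H a c : ℕ} (s : AttnStack H a c) (W : ℕ) (CKQ CV : ℝ) : Prop :=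
  s.width ≤ W ∧ s.maxNormKQ ≤ CKQ ∧ s.maxNormV ≤ CV

theorem BoundedBy.nil {H d W : ℕ} {CKQ CV : ℝ} (hd : d ≤ W) (hKQ : 0 ≤ CKQ) (hV : 0 ≤ CV) :
    (AttnStack.nil (H := H) d).BoundedBy W CKQ CV :=
  ⟨hd, hKQ, hV⟩

theorem BoundedBy.cons_gateHeads {a b c W : ℕ} {CKQ CV lam M : ℝ} {i₁ i₂ : Fin a}
    {L V : Matrix (Fin b) (Fin a) ℝ} {w : Fin a → ℝ} {s : AttnStack 3 b c}
    (hs : s.BoundedBy W CKQ CV) (hlam : 2 ≤ lam) (hM : 0 ≤ M) (hL : ∀ i j, |L i j| ≤ M)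
    (hV : ∀ i j, |V i j| ≤ M) (hw : ∀ j, |w j| ≤ 1) (ha : a ≤ W) (hW : 2 ≤ W)
    (hKQ : 4 * (a : ℝ) ^ 2 ≤ CKQ) (hCV : b * a * (2 * M) ≤ CV) :
    (cons (gateHeads lam i₁ i₂ L V w) s).BoundedBy W CKQ CV := by
  refine ⟨max_le (max_le ha (Finset.sup_le fun h _ => ?_)) hs.1, max_le (ciSup_le fun h => ?_) hs.2.1,
    max_le (ciSup_le fun h => ?_) hs.2.2⟩
  · fin_cases h
    · exact (show 1 ≤ W by omega)
    · exact hW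
    · exact (show 1 ≤ W by omega)
  · exact (norm_WKQ_gateHeads_le lam i₁ i₂ L V hw h).trans hKQ
  · exact (norm_WV_gateHeads_le hlam hM i₁ i₂ w hL hV h).trans hCV

theorem maxNormKQ_pos_of_ne_zero {H a b c : ℕ} (layer : Fin H → AttnHead a b) (s : AttnStack H b c)
    {h : Fin H} (hne : (layer h).WKQ ≠ 0) : 0 < (cons layer s).maxNormKQ :=
  lt_of_lt_of_le (norm_pos_iff.2 hne) ((le_ciSup (f := fun h => ‖(layer h).WKQ‖)
    (Set.finite_range _).bddAbove h).trans (le_max_left _ _))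

theorem maxNormV_pos_of_ne_zero {H a b c : ℕ} (layer : Fin H → AttnHead a b) (s : AttnStack H b c)
    {h : Fin H} (hne : (layer h).WV ≠ 0) : 0 < (cons layer s).maxNormV :=
  lt_of_lt_of_le (norm_pos_iff.2 hne) ((le_ciSup (f := fun h => ‖(layer h).WV‖)
    (Set.finite_range _).bddAbove h).trans (le_max_left _ _))

end AttnStack

/-! ### The bisection network -/

/-- The state `(x, y, t)` of the bisection in the first of two tokens, with positional encoding. -/
def bisectState (x y t : ℝ) : Matrix (Fin 5) (Fin 2) ℝ :=
  !![x, 0; y, 0; t, 0; 1, 0; 0, 1]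

/-- `(x, y, t) ↦ (x, y, η x - y tanh (η y))`. -/
noncomputable def squareLayer (lam η : ℝ) : Fin 3 → AttnHead 5 5 :=
  gateHeads lam 3 4
    !![1, 0, 0, 0, 0; 0, 1, 0, 0, 0; η, 0, 0, 0, 0; 0, 0, 0, 1, 0; 0, 0, 0, 0, 1]
    !![0, 0, 0, 0, 0; 0, 0, 0, 0, 0; 0, -2, 0, 0, 0; 0, 0, 0, 0, 0; 0, 0, 0, 0, 0]
    -- The weight cancels the factor `lam / 2` of the gate: all layers share one large `lam`, yet
    -- this `tanh` must stay in its linear regime. The entry `-2` above cancels the gate's `1/2`.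
    ![0, 2 * η / lam, 0, 0, 0]

/-- `(x, y, t) ↦ (x, y + s tanh (lam t / 2), 0)`. -/
noncomputable def stepLayer (lam s : ℝ) : Fin 3 → AttnHead 5 5 :=
  gateHeads lam 3 4
    !![1, 0, 0, 0, 0; 0, 1, 0, 0, 0; 0, 0, 0, 0, 0; 0, 0, 0, 1, 0; 0, 0, 0, 0, 1]
    !![0, 0, 0, 0, 0; 0, 0, 0, 2 * s, 0; 0, 0, 0, 0, 0; 0, 0, 0, 0, 0; 0, 0, 0, 0, 0]
    ![0, 0, 1, 0, 0]

/-- `x ↦ (x, y, 0)`. -/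
noncomputable def embedLayer (lam y : ℝ) : Fin 3 → AttnHead 3 5 :=
  gateHeads lam 1 2 !![1, 0, 0; 0, y, 0; 0, 0, 0; 0, 1, 0; 0, 0, 1] 0 0

/-- `(x, y, t) ↦ y`. -/
noncomputable def readoutLayer (lam : ℝ) : Fin 3 → AttnHead 5 1 :=
  gateHeads lam 3 4 !![0, 1, 0, 0, 0] 0 0

theorem attnLayer_squareLayer {lam : ℝ} (hlam : 0 < lam) (η x y t : ℝ) :
    attnLayer (squareLayer lam η) lam (bisectState x y t) =
      bisectState x y (η * x - y * Real.tanh (η * y)) := by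
  rw [squareLayer, attnLayer_gateHeads hlam _ _ _ _ rfl rfl rfl rfl
    (by simp [bisectState, Fin.sum_univ_five])]
  have h : lam / 2 * (2 * η / lam * y) = η * y := by field_simp
  ext i j
  fin_cases i <;> fin_cases j <;>
    simp [bisectState, Matrix.mul_apply, Fin.sum_univ_five, h]
  ring

theorem attnLayer_stepLayer {lam : ℝ} (hlam : 0 < lam) (s x y t : ℝ) :
    attnLayer (stepLayer lam s) lam (bisectState x y t) =
      bisectState x (y + s * Real.tanh (lam / 2 * t)) 0 := by
  rw [stepLayer, attnLayer_gateHeads hlam _ _ _ _ rfl rfl rfl rfl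
    (by simp [bisectState, Fin.sum_univ_five])]
  ext i j
  fin_cases i <;> fin_cases j <;>
    simp [bisectState, Matrix.mul_apply, Fin.sum_univ_five]
  ring

theorem preprocess_one (x : ℝ) :
    (preprocess !![x] : Matrix (Fin 3) (Fin 2) ℝ) = !![x, 0; 1, 0; 0, 1] := by
  ext i j
  fin_cases i <;> fin_cases j <;> rfl

theorem attnLayer_embedLayer {lam : ℝ} (hlam : 0 < lam) (y x : ℝ) :
    attnLayer (embedLayer lam y) lam !![x, 0; 1, 0; 0, 1] = bisectState x y 0 := by
  rw [embedLayer, attnLayer_gateHeads hlam _ _ _ _ rfl rfl rfl rfl (by simp)]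
  ext i j
  fin_cases i <;> fin_cases j <;>
    simp [bisectState, Matrix.mul_apply, Fin.sum_univ_three]

theorem attnLayer_readoutLayer {lam : ℝ} (hlam : 0 < lam) (x y t : ℝ) :
    attnLayer (readoutLayer lam) lam (bisectState x y t) 0 0 = y := by
  rw [readoutLayer, attnLayer_gateHeads hlam _ _ _ _ rfl rfl rfl rfl (by simp)]
  simp [bisectState, Matrix.mul_apply, Fin.sum_univ_five]

namespace AttnStack

/-- `n` bisection steps with first step width `s`, followed by the readout. -/
noncomputable def bisect (lam η : ℝ) : ℕ → ℝ → AttnStack 3 5 1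
  | 0, _ => cons (readoutLayer lam) (nil 1)
  | n + 1, s => cons (squareLayer lam η) (cons (stepLayer lam s) (bisect lam η n (s / 2)))

/-- The Transformer that approximates the square root on `[0, R ^ 2]` by `n` bisection steps. -/
noncomputable def sqrtNet (lam η R : ℝ) (n : ℕ) : AttnStack 3 3 1 :=
  cons (embedLayer lam (R / 2)) (bisect lam η n (R / 4))

theorem eval_bisect {lam : ℝ} (hlam : 0 < lam) (η x : ℝ) (n : ℕ) : ∀ s y t : ℝ,
    (bisect lam η n s).eval lam (bisectState x y t) 0 0 = softBisect η (lam / 2) x n s y := by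
  induction n with
  | zero => intro s y t; exact attnLayer_readoutLayer hlam x y t
  | succ n ih =>
    intro s y t
    rw [bisect, eval, eval, attnLayer_squareLayer hlam, attnLayer_stepLayer hlam, ih, softBisect]

theorem eval_sqrtNet {lam : ℝ} (hlam : 0 < lam) (η R x : ℝ) (n : ℕ) :
    (sqrtNet lam η R n).eval lam (preprocess !![x]) 0 0 =
      softBisect η (lam / 2) x n (R / 4) (R / 2) := by
  rw [preprocess_one, sqrtNet, eval, attnLayer_embedLayer hlam, eval_bisect hlam]

theorem depth_bisect (lam η : ℝ) (n : ℕ) : ∀ s : ℝ, (bisect lam η n s).depth = 2 * n + 1 := by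
  induction n with
  | zero => intro s; rfl
  | succ n ih => intro s; rw [bisect, depth, depth, ih]; ring

theorem depth_sqrtNet (lam η R : ℝ) (n : ℕ) : (sqrtNet lam η R n).depth = 2 * n + 2 := by
  rw [sqrtNet, depth, depth_bisect]

/-- Here `M` dominates all entries of the `L` and `V` matrices, notably `-2` and `2 * s`. The
constants are `4 * 5²` and `5 * 5 * (2 * M)`. -/
theorem boundedBy_bisect {lam η M : ℝ} (hlam : 2 ≤ lam) (hη0 : 0 ≤ η) (hη : η ≤ 1) (hM : 2 ≤ M)
    (n : ℕ) : ∀ s : ℝ, 0 ≤ s → 2 * s ≤ M → (bisect lam η n s).BoundedBy 5 100 (50 * M) := by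
  have hM0 : 0 ≤ M := by linarith
  have hM1 : 1 ≤ M := by linarith
  have hηM : η ≤ M := by linarith
  induction n with
  | zero =>
    intro s _ _
    refine (BoundedBy.nil (by norm_num) (by norm_num) (by positivity)).cons_gateHeads hlam hM0
      ?_ ?_ ?_ le_rfl (by norm_num) (by norm_num) (by norm_num; linarith)
    · intro i j
      fin_cases i
      fin_cases j <;> simp [hM0, hM1]
    · intro i j
      simpa using hM0
    · simp
  | succ n ih =>
    intro s hs hsM
    have h2 : |2 * s| ≤ M := by rwa [abs_of_nonneg (by positivity)]
    have h3 : |2 * η / lam| ≤ 1 := by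
      rw [abs_of_nonneg (by positivity), div_le_one (by linarith)]
      linarith
    have h4 : |η| ≤ M := by rwa [abs_of_nonneg hη0]
    have hstep : (cons (stepLayer lam s) (bisect lam η n (s / 2))).BoundedBy 5 100 (50 * M) := by
      refine (ih (s / 2) (by positivity) (by linarith)).cons_gateHeads hlam hM0 ?_ ?_ ?_
        le_rfl (by norm_num) (by norm_num) (by norm_num; linarith)
      · intro i j
        fin_cases i <;> fin_cases j <;> simp [hM0, hM1]
      · intro i j
        fin_cases i <;> fin_cases j <;> simp [hM0]
        simpa using h2
      · intro j
        fin_cases j <;> simp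
    refine hstep.cons_gateHeads hlam hM0 ?_ ?_ ?_
      le_rfl (by norm_num) (by norm_num) (by norm_num; linarith)
    · intro i j
      fin_cases i <;> fin_cases j <;> simp [hM0, hM1, h4]
    · intro i j
      fin_cases i <;> fin_cases j <;> simp [hM0, hM]
    · intro j
      fin_cases j <;> simp
      simpa using h3

theorem boundedBy_sqrtNet {lam η R : ℝ} (hlam : 2 ≤ lam) (hη0 : 0 ≤ η) (hη : η ≤ 1) (hR : 1 ≤ R)
    (n : ℕ) : (sqrtNet lam η R n).BoundedBy 5 100 (100 * R) := by
  have h := boundedBy_bisect hlam hη0 hη (by linarith : 2 ≤ 2 * R) n (R / 4)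
    (by linarith) (by linarith)
  rw [show 50 * (2 * R) = 100 * R by ring] at h
  have h1 : |R / 2| ≤ 2 * R := by
    rw [abs_of_nonneg (by linarith)]
    linarith
  have h2 : 1 ≤ 2 * R := by linarith
  have h3 : 0 ≤ R := by linarith
  refine h.cons_gateHeads hlam (by linarith : 0 ≤ 2 * R) ?_ ?_ ?_ (by norm_num) (by norm_num)
    (by norm_num) (by norm_num; linarith)
  · intro i j
    fin_cases i <;> fin_cases j <;> simp [h2, h3]
    simpa using h1
  · intro i j
    simpa using h3
  · simp

theorem maxNormKQ_sqrtNet_pos (lam η R : ℝ) (n : ℕ) : 0 < (sqrtNet lam η R n).maxNormKQ := by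
  refine maxNormKQ_pos_of_ne_zero _ _ (h := 1) fun h => ?_
  have h1 := congrFun (congrFun h 1) 1
  change (((Matrix.of fun (k : Fin 2) (j : Fin 3) =>
    if j = ![1, 2] k then (1 : ℝ) else 0).transpose) * (Matrix.of fun (k : Fin 2) (j : Fin 3) =>
    if j = ![1, 2] k then (1 : ℝ) else 0)) 1 1 = 0 at h1
  simp [Matrix.mul_apply, Fin.sum_univ_two] at h1

theorem maxNormV_sqrtNet_pos {lam : ℝ} (hlam : 0 < lam) (η R : ℝ) (n : ℕ) :
    0 < (sqrtNet lam η R n).maxNormV := by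
  refine maxNormV_pos_of_ne_zero _ _ (h := 1) fun h => ?_
  have h1 := congrFun (congrFun h 0) 0
  change ((Real.exp lam + 1) / (Real.exp lam - 1)) * 1 = 0 at h1
  have := Real.add_one_lt_exp hlam.ne'
  rw [mul_one, div_eq_zero_iff] at h1
  rcases h1 with h1 | h1 <;> linarith

end AttnStack

/-! ### Choice of parameters and the final estimate -/

/-- Enough bisection steps approximate the square root up to `2 ε`, for suitable parameters. -/
theorem abs_softBisect_sub_sqrt_le {ε x' x : ℝ} (hε0 : 0 < ε) (hε1 : ε < 1) (hx : ε ≤ x)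
    (hx1 : x ≤ 1 / ε) {n : ℕ} (hn : (1 / ε) ^ 2 ≤ 2 ^ n) :
    |softBisect (ε ^ 2 / 4) (128 * (1 / ε) ^ 6 / 2) x' n (√(1 / ε) / 4) (√(1 / ε) / 2) - √x| ≤
      2 * ε + |x' - x| / √ε := by
  set R := √(1 / ε) with hRdef
  have hδ1 : 1 < 1 / ε := by rwa [lt_div_iff₀ hε0, one_mul]
  have hR2 : R ^ 2 = 1 / ε := Real.sq_sqrt (by positivity)
  have hR1 : 1 ≤ R := Real.one_le_sqrt.2 hδ1.le
  have hR0 : 0 < R := by linarith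
  have hεR : ε * R ^ 2 = 1 := by rw [hR2]; field_simp
  have hεR1 : ε * R ≤ 1 := by nlinarith
  have hclip := abs_clippedSqrt_sub_sqrt_le (x' := x') (R := R) hε0 hx (by rwa [hR2])
  set r := √(max 0 (min x' (R ^ 2))) with hr
  have hr2 : r ^ 2 = max 0 (min x' (R ^ 2)) := Real.sq_sqrt (le_max_left _ _)
  have hr0 : 0 ≤ r := Real.sqrt_nonneg _
  have hrR : r ≤ R := by
    refine abs_le_of_sq_le_sq' ?_ hR0.le |>.2
    rw [hr2]
    exact max_le (by positivity) (min_le_right _ _)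
  -- The constant 128 makes `Λ * (η * μ² / 2) = 1 / τ` an equality.
  have hmain := abs_softBisect_sub_le (η := ε ^ 2 / 4) (Λ := 128 * (1 / ε) ^ 6 / 2) (x := x')
    (R := R) (μ := ε / 2) (τ := ε ^ 2 / 2) (r := r) (by positivity) (by positivity) hR0
    (by positivity) (by positivity)
    (by
      rw [show R ^ 4 = (R ^ 2) ^ 2 by ring, hR2]
      field_simp
      norm_num)
    (by
      apply le_of_eq
      field_simp
      norm_num)
    hr0
    (by
      intro h
      have h1 : 0 < r ^ 2 := by positivity
      rw [hr2] at h1 ⊢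
      rcases lt_max_iff.1 h1 with h1 | h1
      · exact absurd h1 (lt_irrefl _)
      · rw [max_eq_right h1.le]
        exact min_le_left _ _)
    (by
      intro h
      have h1 : r ^ 2 < R ^ 2 := by gcongr
      rw [hr2] at h1 ⊢
      have h2 := (le_max_right _ _).trans_lt h1
      rw [min_lt_iff] at h2
      rcases h2 with h2 | h2
      · rw [min_eq_left h2.le]
        exact le_max_right _ _
      · exact absurd h2 (lt_irrefl _))
    n (R / 4) (R / 2) (by positivity) (by linarith) (by linarith)
    (by
      have h1 : 0 ≤ ε ^ 2 / 2 * R := by positivity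
      rw [abs_le]
      constructor <;> nlinarith)
  -- The remaining interval, the dead zone and the soft-sign defect contribute at most `ε / 2` each.
  have hfin : (1 - ε ^ 2 / 2) * (2 * (R / 4) / 2 ^ n) + (ε / 2 + ε ^ 2 / 2 * R) ≤ 2 * ε := by
    have h1 : 2 * (R / 4) / 2 ^ n ≤ ε / 2 := by
      rw [div_le_iff₀ (by positivity)]
      have : ε / 2 * (1 / ε) ^ 2 ≤ ε / 2 * 2 ^ n := by gcongr
      have h3 : ε / 2 * (1 / ε) ^ 2 = R ^ 2 / 2 := by rw [hR2]; field_simp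
      nlinarith
    have h2 : 0 ≤ 2 * (R / 4) / 2 ^ n := by positivity
    have h3 : 0 ≤ ε ^ 2 / 2 := by positivity
    have h4 : ε ^ 2 / 2 * R ≤ ε / 2 := by
      calc ε ^ 2 / 2 * R = ε / 2 * (ε * R) := by ring
        _ ≤ ε / 2 * 1 := by gcongr
        _ = _ := mul_one _
    nlinarith [mul_nonneg h3 h2]
  have := abs_sub_le (softBisect (ε ^ 2 / 4) (128 * (1 / ε) ^ 6 / 2) x' n (R / 4) (R / 2)) r (√x)
  linarith

theorem mainTheorem7 :
    ∃ (C : ℝ) (p q : Polynomial ℝ), 0 < C ∧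
      ∀ CX : ℝ, 0 < CX → ∀ ε : ℝ, 0 < ε → ε < 1 →
        ∃ (H W K : ℕ) (CKQ CV lam : ℝ), 0 < CKQ ∧ 0 < CV ∧ 0 < lam ∧
          ∃ f ∈ TransformerClass 1 1 1 H W K CKQ CV lam,
            (∀ x' ∈ Set.Icc (-CX) CX, ∀ x ∈ Set.Icc ε (1 / ε),
              |f !![x'] 0 0 - Real.sqrt x| ≤ 2 * ε + |x' - x| / Real.sqrt ε) ∧
            (1 ≤ CX → ε ≤ 1 / 2 → ∀ δ : ℝ, δ = 1 / ε →
              (H : ℝ) ≤ C * Real.log δ ^ 3 ∧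
              (W : ℝ) ≤ C * Real.log δ ^ 3 ∧
              (K : ℝ) ≤ C * Real.log δ ^ 2 ∧
              CV ≤ C * (δ * Real.sqrt (Real.log δ ^ 3)) ∧
              CKQ ≤ C * Real.sqrt (Real.log δ ^ 2 * Real.log (δ * CX)) ∧
              lam ≤ C * (δ ^ (p.eval (Real.log δ)) * Real.log δ ^ (q.eval (Real.log δ)) *
                Real.log (δ * CX))) := by
  refine ⟨1000, Polynomial.C 6, 0, by norm_num, fun CX _ ε hε0 hε1 => ?_⟩
  have hδ1 : 1 < 1 / ε := by rwa [lt_div_iff₀ hε0, one_mul]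
  have hlam2 : 2 ≤ 128 * (1 / ε) ^ 6 := by
    have : 1 ≤ (1 / ε) ^ 6 := one_le_pow₀ hδ1.le
    linarith
  have hlam0 : 0 < 128 * (1 / ε) ^ 6 := by linarith
  -- The factor 3 works because `3 * ln 2 > 2`, so that `2 ^ n ≥ (1 / ε) ^ 2`.
  set n := ⌈3 * Real.log (1 / ε)⌉₊ with hn
  have hn1 : 3 * Real.log (1 / ε) ≤ n := Nat.le_ceil _
  have hpow : (1 / ε) ^ 2 ≤ (2 : ℝ) ^ n := by
    have hl2 := Real.log_two_gt_d9
    have hlδ := Real.log_pos hδ1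
    rw [← Real.log_le_log_iff (by positivity) (by positivity), Real.log_pow, Real.log_pow]
    push_cast
    nlinarith
  set s := AttnStack.sqrtNet (128 * (1 / ε) ^ 6) (ε ^ 2 / 4) (√(1 / ε)) n with hs
  obtain ⟨hW, hKQ, hV⟩ := AttnStack.boundedBy_sqrtNet (η := ε ^ 2 / 4) hlam2 (by positivity)
    (by nlinarith) (Real.one_le_sqrt.2 hδ1.le) n
  refine ⟨3, s.width, s.depth, s.maxNormKQ, s.maxNormV, 128 * (1 / ε) ^ 6,
    AttnStack.maxNormKQ_sqrtNet_pos _ _ _ _, AttnStack.maxNormV_sqrtNet_pos hlam0 _ _ _, hlam0,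
    fun X => truncateLast (s.eval _ (preprocess X)),
    ⟨s, rfl, rfl, rfl, rfl, fun _ => rfl⟩, ?_, ?_⟩
  · intro x' _ x hx
    have h := AttnStack.eval_sqrtNet hlam0 (ε ^ 2 / 4) (√(1 / ε)) x' n
    change |s.eval _ (preprocess !![x']) 0 0 - _| ≤ _
    rw [hs, h]
    exact abs_softBisect_sub_sqrt_le hε0 hε1 hx.1 hx.2 hpow
  · intro hCX hε2 δ hδ
    have hδ2 : 2 ≤ δ := by
      rw [hδ, le_div_iff₀ hε0]
      linarith
    have hlog : 69 / 100 ≤ Real.log δ := by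
      have := Real.log_le_log (by norm_num) hδ2
      linarith [Real.log_two_gt_d9]
    -- The network does not depend on `CX`; `1 ≤ CX` only keeps this logarithm away from zero.
    have hlogX : Real.log δ ≤ Real.log (δ * CX) :=
      Real.log_le_log (by linarith) (by nlinarith)
    have hlog2 : (69 / 100) ^ 2 ≤ Real.log δ ^ 2 := pow_le_pow_left₀ (by norm_num) hlog 2
    have hlog3 : (69 / 100) ^ 3 ≤ Real.log δ ^ 3 := pow_le_pow_left₀ (by norm_num) hlog 3
    rw [← hδ] at hn ⊢
    refine ⟨?_, ?_, ?_, ?_, ?_, ?_⟩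
    · push_cast
      linarith
    · have : (s.width : ℝ) ≤ 5 := by exact_mod_cast hW
      linarith
    · rw [hs, AttnStack.depth_sqrtNet]
      have : (n : ℝ) < 3 * Real.log δ + 1 := by
        rw [hn]
        exact Nat.ceil_lt_add_one (by linarith)
      push_cast
      nlinarith
    · have h1 : √δ ≤ δ := Real.sqrt_le_iff.2 ⟨by linarith, by nlinarith⟩
      have h2 : 1 / 2 ≤ √(Real.log δ ^ 3) := Real.le_sqrt_of_sq_le (by linarith)
      have h3 : δ * (1 / 2) ≤ δ * √(Real.log δ ^ 3) := by gcongr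
      rw [← hδ] at hV
      have hV' : s.maxNormV ≤ 100 * √δ := by rwa [hs, ← hδ]
      linarith
    · have h1 : 1 / 2 ≤ √(Real.log δ ^ 2 * Real.log (δ * CX)) := by
        apply Real.le_sqrt_of_sq_le
        nlinarith
      linarith
    · rw [Polynomial.eval_C, Polynomial.eval_zero, Real.rpow_zero, mul_one]
      norm_cast
      have : 0 ≤ δ ^ 6 := by positivity
      nlinarith
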